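/- **Proposition (Noether's theorem for the structure-preserving kernel estimator).** Let $(P,\{\cdot,\cdot\})$ be a finite-dimensional smooth (Hausdorff, second countable) Poisson manifold, i.e. $\{\cdot,\cdot\}$ is a Lie bracket on $C^\infty(P)$ that is a derivation in each factor, and let $P$ carry a Riemannian metric $g$. The Poisson tensor is $B(z)(\mathbf dF(z),\mathbf dF'(z))=\{F,F'\}(z)$, the map $B^\sharp:T^*P\to TP$ is given by $B(z)(\alpha,\beta)=\alpha\cdot B^\sharp(z)(\beta)$, and $X_h=B^\sharp(\mathbf dh)$ is the Hamiltonian vector field of a differentiable function $h$. Let $G$ be a finite-dimensional Lie group with Lie algebra $\mathfrak g$ acting smoothly and canonically on $P$, that is, $\{F\circ\Phi_a,F'\circ\Phi_a\}=\{F,F'\}\circ\Phi_a$ for all $a\in G$ and $F,F'\in C^\infty(P)$, where $\Phi_a(p)=a\cdot p$. Let $K:P\times P\to\mathbb R$ be a Mercer kernel (symmetric and positive semidefinite) of class $C^3$ that is argumentwise $G$-invariant: $K(a\cdot p,b\cdot q)=K(p,q)$ for all $a,b\in G$ and $p,q\in P$. Let $\mathcal H_K$ be its reproducing kernel Hilbert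 space. Let $N\ge 1$, $\lambda>0$, let $z_1,\dots,z_N\in P$ and $x_n\in T_{z_n}P$ be the data, and let $\widehat h_{\lambda,N}\in\mathcal H_K$ be the structure-preserving kernel estimator, i.e. the minimizer over $h\in\mathcal H_K$ of $$\widehat R_{\lambda,N}(h)=\frac1N\sum_{n=1}^N\|X_h(z_n)-x_n\|_g^2+\lambda\|h\|_{\mathcal H_K}^2 .$$ 1. The estimator is $G$-invariant: $\widehat h_{\lambda,N}(a\cdot p)=\widehat h_{\lambda,N}(p)$ for all $a\in G$, $p\in P$. 2. If $\mathbf J:P\to\mathfrak g^*$ is a momentum map of the action (that is, for every $\xi\in\mathfrak g$ the function $\mathbf J^\xi=\langle\mathbf J(\cdot),\xi\rangle$ is smooth and the infinitesimal generator $\xi_P$ of the action equals $X_{\mathbf J^\xi}$), then $\mathbf J$ is conserved by the (possibly only locally defined) flow $F_t$ of $X_{\widehat h_{\lambda,N}}$: $\mathbf J(F_t(p))=\mathbf J(p)$ whenever $F_t(p)$ is defined. -/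

import Mathlib

open Set
open scoped Manifold ContDiff

namespace PoissonLearning

section Poisson

variable {E : Type*} [NormedAddCommGroup E] [NormedSpace ℝ E]
  {P : Type*} [TopologicalSpace P] [ChartedSpace E P]

/-- The algebra `C^∞(P)` of smooth real-valued functions on the manifold `P`. -/
abbrev Smooth (E : Type*) [NormedAddCommGroup E] [NormedSpace ℝ E]
    (P : Type*) [TopologicalSpace P] [ChartedSpace E P] : Type _ :=
  ContMDiffMap 𝓘(ℝ, E) 𝓘(ℝ, ℝ) P ℝ ∞

/-- The cotangent space `T_z^* P`. -/
abbrev Cotangent (E : Type*) [NormedAddCommGroup E] [NormedSpace ℝ E]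
    {P : Type*} [TopologicalSpace P] [ChartedSpace E P] (z : P) : Type _ :=
  TangentSpace 𝓘(ℝ, E) z →L[ℝ] ℝ

variable (E) in
/-- The differential `dh(z) ∈ T_z^* P` of a real function. -/
noncomputable def differential (h : P → ℝ) (z : P) : Cotangent E z :=
  mvfderiv 𝓘(ℝ, E) h z

variable (E P) in
/-- A Poisson bracket on `P`: a Lie bracket on `C^∞(P)` that is a derivation in each factor. -/
structure PoissonBracket where
  bracket : Smooth E P →ₗ[ℝ] Smooth E P →ₗ[ℝ] Smooth E P
  self_bracket : ∀ F, bracket F F = 0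
  jacobi : ∀ F G H, bracket F (bracket G H) + bracket G (bracket H F)
    + bracket H (bracket F G) = 0
  leibniz : ∀ F G H, bracket (F * G) H = bracket F H * G + F * bracket G H

/-- The Poisson tensor: `B(z)(α, β) = {F, G}(z)` for any smooth `F`, `G` with `dF(z) = α` and
`dG(z) = β` (the value does not depend on the choice). -/
noncomputable def PoissonBracket.tensor (π : PoissonBracket E P) (z : P)
    (α β : Cotangent E z) : ℝ :=
  Classical.epsilon fun r : ℝ => ∃ F G : Smooth E P,
    differential E F z = α ∧ differential E G z = β ∧ π.bracket F G z = r

/-- The bundle map `B^♯ : T^*P → TP`: `B^♯(z)(β)` is the unique tangent vector `v` at `z` with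
`B(z)(α, β) = α(v)` for all `α`. -/
noncomputable def PoissonBracket.sharp (π : PoissonBracket E P) (z : P)
    (β : Cotangent E z) : TangentSpace 𝓘(ℝ, E) z :=
  Classical.epsilon fun v : TangentSpace 𝓘(ℝ, E) z =>
    ∀ α : Cotangent E z, π.tensor z α β = α v

/-- The Hamiltonian vector field `X_h = B^♯(dh)` of a differentiable function `h`. -/
noncomputable def PoissonBracket.hamVF (π : PoissonBracket E P) (h : P → ℝ) (z : P) :
    TangentSpace 𝓘(ℝ, E) z :=
  π.sharp z (differential E h z)

/-- `FlowsTo X t z w`: the (possibly only locally defined) flow `F_t` of the vector field `X` is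
defined at `z`, and `F_t(z) = w`; that is, some integral curve of `X` on an open interval containing
`0` and `t` is at `z` at time `0` and at `w` at time `t`. -/
def FlowsTo (X : ∀ z : P, TangentSpace 𝓘(ℝ, E) z) (t : ℝ) (z w : P) : Prop :=
  ∃ (γ : ℝ → P) (a b : ℝ), (0 : ℝ) ∈ Ioo a b ∧ t ∈ Ioo a b ∧
    IsMIntegralCurveOn γ X (Ioo a b) ∧ γ 0 = z ∧ γ t = w

end Poisson

section Kernel

/-- Mercer kernels: symmetric positive semidefinite functions. -/
structure IsMercerKernel {X : Type*} (K : X → X → ℝ) : Prop where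
  symm : ∀ x y, K x y = K y x
  nonneg : ∀ (n : ℕ) (x : Fin n → X) (c : Fin n → ℝ),
    0 ≤ ∑ i, ∑ j, c i * c j * K (x i) (x j)

/-- The Hilbert space `H` of real functions on `X` is the reproducing kernel Hilbert space of `K`:
it contains every section `K(x, ·)`, and `f(x) = ⟪f, K(x, ·)⟫` for all `f` in `H`. -/
def IsRKHSOf {X : Type*} (H : Type*) [NormedAddCommGroup H] [InnerProductSpace ℝ H]
    [RKHS ℝ H X ℝ] (K : X → X → ℝ) : Prop :=
  ∀ x : X, ∃ k : H, (∀ y, k y = K x y) ∧ ∀ f : H, f x = inner ℝ f k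

end Kernel

section Estimator

variable {E : Type*} [NormedAddCommGroup E] [NormedSpace ℝ E]
  {P : Type*} [TopologicalSpace P] [ChartedSpace E P] [IsManifold 𝓘(ℝ, E) ∞ P]

variable (E P) in
/-- Smooth Riemannian metrics on `P`. -/
abbrev RiemannianMetricOn : Type _ :=
  Bundle.ContMDiffRiemannianMetric (B := P) 𝓘(ℝ, E) ∞ E (fun z : P => TangentSpace 𝓘(ℝ, E) z)

variable {H : Type*} [NormedAddCommGroup H] [InnerProductSpace ℝ H] [RKHS ℝ H P ℝ]

/-- The regularized empirical risk
`R(h) = (1/N) ∑ₙ ‖X_h(zₙ) - xₙ‖²_g + lam ‖h‖²` of `h ∈ H`, for the sample points `zₙ ∈ P`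
and the observed vectors `xₙ ∈ T_{zₙ} P`. -/
noncomputable def empiricalRisk (π : PoissonBracket E P) (g : RiemannianMetricOn E P) {N : ℕ}
    (z : Fin N → P) (x : ∀ n, TangentSpace 𝓘(ℝ, E) (z n)) (lam : ℝ) (h : H) : ℝ :=
  (1 / (N : ℝ)) *
      ∑ n, g.inner (z n) (π.hamVF (fun p => h p) (z n) - x n)
        (π.hamVF (fun p => h p) (z n) - x n)
    + lam * ‖h‖ ^ 2

/-- `h ∈ H` is the structure-preserving kernel estimator: it minimizes the regularized empirical
risk over `H`. -/
def IsKernelEstimator (π : PoissonBracket E P) (g : RiemannianMetricOn E P) {N : ℕ}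
    (z : Fin N → P) (x : ∀ n, TangentSpace 𝓘(ℝ, E) (z n)) (lam : ℝ) (h : H) : Prop :=
  ∀ f : H, empiricalRisk π g z x lam h ≤ empiricalRisk π g z x lam f

end Estimator

section Symmetry

/-- `G`-invariant functions. -/
def IsGInvariant (G : Type*) {P : Type*} [SMul G P] (h : P → ℝ) : Prop :=
  ∀ (a : G) (p : P), h (a • p) = h p

/-- Argumentwise `G`-invariant kernels. -/
def IsArgumentwiseInvariant (G : Type*) {P : Type*} [SMul G P] (K : P → P → ℝ) : Prop :=
  ∀ (a b : G) (p q : P), K (a • p) (b • q) = K p q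

variable {EG : Type*} [NormedAddCommGroup EG] [NormedSpace ℝ EG]
  {G : Type*} [TopologicalSpace G] [ChartedSpace EG G] [Group G]
  {E : Type*} [NormedAddCommGroup E] [NormedSpace ℝ E]
  {P : Type*} [TopologicalSpace P] [ChartedSpace E P] [MulAction G P]

/-- The action is canonical: `{F ∘ Φ_a, F' ∘ Φ_a} = {F, F'} ∘ Φ_a` for all `a ∈ G` and all smooth
`F`, `F'`, where `Φ_a(p) = a • p`. -/
def IsCanonicalAction (G : Type*) [Group G] [MulAction G P] (π : PoissonBracket E P) : Prop :=
  ∀ (a : G) (F F' Fa Fa' : Smooth E P),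
    (∀ p, Fa p = F (a • p)) → (∀ p, Fa' p = F' (a • p)) →
      ∀ p, π.bracket Fa Fa' p = π.bracket F F' (a • p)

/-- The infinitesimal generator `ξ_P` of the action along `ξ ∈ 𝔤 = T_1 G`: its value at `p` is the
derivative at `1` of the orbit map `a ↦ a • p` in the direction `ξ`. -/
noncomputable def infGenerator (ξ : GroupLieAlgebra 𝓘(ℝ, EG) G) (p : P) :
    TangentSpace 𝓘(ℝ, E) p :=
  mfderiv 𝓘(ℝ, EG) 𝓘(ℝ, E) (fun a : G => a • p) 1 ξ

/-- `J : P → 𝔤^*` is a momentum map of the action: for every `ξ ∈ 𝔤` the function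
`J^ξ = ⟨J(·), ξ⟩` is smooth, and `ξ_P` is its Hamiltonian vector field. -/
def IsMomentumMap (π : PoissonBracket E P)
    (J : P → Module.Dual ℝ (GroupLieAlgebra 𝓘(ℝ, EG) G)) : Prop :=
  ∀ ξ : GroupLieAlgebra 𝓘(ℝ, EG) G,
    ContMDiff 𝓘(ℝ, E) 𝓘(ℝ, ℝ) ∞ (fun p => J p ξ) ∧
      ∀ p : P, (infGenerator ξ p : TangentSpace 𝓘(ℝ, E) p) = π.hamVF (fun q => J q ξ) p

end Symmetry

end PoissonLearning

open PoissonLearning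

/-! Argumentwise invariance gives `K (a • p) w = K p w`, so the sections of `K` at `p` and at `a •
p` are the same vector of `H`. By the reproducing property every element of `H`, in particular the
estimator, is then `G`-invariant (`IsRKHSOf.isGInvariant`).

For conservation, antisymmetry of the Poisson tensor gives dJ^ξ(X_h) = -dh(X_{J^ξ}) = -dh(ξ_P), and
the last term vanishes because h is constant on orbits.

Two facts make this computation legitimate. The tensor and `sharp` are defined by choice, so the
bracket at a point must be shown to depend only on the two differentials
(`PoissonBracket.bracket_apply_congr`, by locality and Hadamard's lemma). The elements of `H` must
be differentiable (`IsRKHSOf.mdifferentiableAt`): the feature map is locally Lipschitz, so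
differentiability at a point is a closed condition on `H`, and it holds on the kernel sections,
whose span is dense. -/

namespace PoissonLearning

/-! ### Hadamard's lemma and smooth cutoffs in a normed space -/

section Hadamard

variable {E : Type*} [NormedAddCommGroup E] [NormedSpace ℝ E]
  {F : Type*} [NormedAddCommGroup F] [NormedSpace ℝ F]

/-- The integral over `[0, 1]` of a smooth function depends smoothly on parameters. -/
theorem contDiff_integral_unitInterval {u : E → ℝ → F} (hu : ContDiff ℝ ∞ ↿u) :
    ContDiff ℝ ∞ fun y => ∫ t in (0 : ℝ)..1, u y t := by
  -- The integral is the value at 0 of the convolution of the indicator of (0, 1] with s ↦ ρ(s) u(y,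
  -- -s). The cutoff ρ supplies compact support and equals 1 wherever the indicator looks.
  let ρ : ContDiffBump (0 : ℝ) := ⟨1, 2, one_pos, one_lt_two⟩
  let f : ℝ → ℝ := indicator (Ioc 0 1) 1
  have hf : MeasureTheory.LocallyIntegrable f := by
    refine MeasureTheory.Integrable.locallyIntegrable ?_
    rw [MeasureTheory.integrable_indicator_iff measurableSet_Ioc]
    exact MeasureTheory.integrableOn_const (by simp)
  have hg : ContDiff ℝ ∞ ↿(fun (y : E) (s : ℝ) => ρ s • u y (-s)) :=
    (ρ.contDiff.comp contDiff_snd).smul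
      (hu.comp (contDiff_fst.prodMk contDiff_snd.neg) :)
  have key := MeasureTheory.contDiffOn_convolution_right_with_param (n := ⊤)
    (μ := MeasureTheory.volume) (ContinuousLinearMap.lsmul ℝ ℝ : ℝ →L[ℝ] F →L[ℝ] F)
    (s := univ) (k := Metric.closedBall 0 2) isOpen_univ (isCompact_closedBall _ _)
    (fun y s _ hs => by
      have : ρ s = 0 := ρ.zero_of_le_dist (by
        simpa [ρ] using (not_le.1 (fun h => hs (Metric.mem_closedBall.2 h))).le)
      simp [this]) hf hg.contDiffOn
  rw [univ_prod_univ, contDiffOn_univ] at key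
  convert key.comp (contDiff_id.prodMk (contDiff_const (c := (0 : ℝ)))) using 1
  ext y
  simp only [Function.comp, MeasureTheory.convolution, id, zero_sub, neg_neg,
    ContinuousLinearMap.lsmul_apply]
  rw [intervalIntegral.integral_of_le zero_le_one,
    ← MeasureTheory.integral_indicator measurableSet_Ioc]
  congr 1
  ext t
  by_cases ht : t ∈ Ioc (0 : ℝ) 1
  · have : ρ (-t) = 1 := ρ.one_of_mem_closedBall (by
      simpa [ρ, abs_le] using ⟨by linarith [ht.1], ht.2⟩)
    simp [f, ht, this]
  · simp [f, ht]

/-- Hadamard's lemma: a smooth function vanishing at `y₀` is a smooth family of linear forms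
applied to `y - y₀`. -/
theorem exists_contDiff_sub_eq_apply [CompleteSpace F] {f : E → F} (hf : ContDiff ℝ ∞ f) (y₀ : E) :
    ∃ L : E → E →L[ℝ] F, ContDiff ℝ ∞ L ∧ L y₀ = fderiv ℝ f y₀ ∧
      ∀ y, f y - f y₀ = L y (y - y₀) := by
  have hseg : ContDiff ℝ ∞ fun q : E × ℝ => y₀ + q.2 • (q.1 - y₀) := by fun_prop
  have hdf : ContDiff ℝ ∞ (fderiv ℝ f) := hf.fderiv_right le_rfl
  -- `L y` averages the derivative of `f` over the segment from `y₀` to `y`.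
  refine ⟨fun y => ∫ t in (0 : ℝ)..1, fderiv ℝ f (y₀ + t • (y - y₀)),
    contDiff_integral_unitInterval (hdf.comp hseg), by simp, fun y => ?_⟩
  have hcont : Continuous fun t : ℝ => fderiv ℝ f (y₀ + t • (y - y₀)) :=
    hdf.continuous.comp (by fun_prop)
  have hd : ∀ t ∈ uIcc (0 : ℝ) 1, HasDerivAt (fun t : ℝ => f (y₀ + t • (y - y₀)))
      (fderiv ℝ f (y₀ + t • (y - y₀)) (y - y₀)) t := fun t _ => by
    have h1 : HasDerivAt (fun t : ℝ => y₀ + t • (y - y₀)) (y - y₀) t := by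
      simpa using ((hasDerivAt_id t).smul_const (y - y₀)).const_add y₀
    exact ((hf.differentiable (by simp)) _).hasFDerivAt.comp_hasDerivAt t h1
  have h := intervalIntegral.integral_eq_sub_of_hasDerivAt hd
    ((hcont.clm_apply continuous_const).intervalIntegrable _ _)
  beta_reduce
  rw [ContinuousLinearMap.intervalIntegral_apply (hcont.intervalIntegrable _ _), h]
  simp

/-- A function smooth near a point agrees near that point with a globally smooth function. -/
theorem exists_contDiff_eventuallyEq [FiniteDimensional ℝ E] {f : E → F} {s : Set E} {y₀ : E}
    (hs : s ∈ nhds y₀) (hf : ContDiffOn ℝ ∞ f s) :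
    ∃ f' : E → F, ContDiff ℝ ∞ f' ∧ f' =ᶠ[nhds y₀] f := by
  obtain ⟨r, hr, hrs⟩ := Metric.mem_nhds_iff.1 hs
  let ψ : ContDiffBump y₀ := ⟨r / 4, r / 2, by positivity, by linarith⟩
  refine ⟨fun y => ψ y • f y, contDiff_iff_contDiffAt.2 fun y => ?_, ?_⟩
  · by_cases hy : y ∈ Metric.ball y₀ r
    · exact ψ.contDiff.contDiffAt.smul
        (hf.contDiffAt (Filter.mem_of_superset (Metric.isOpen_ball.mem_nhds hy) hrs))
    · refine (contDiffAt_const (c := (0 : F))).congr_of_eventuallyEq ?_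
      have : y ∉ tsupport ψ := by
        rw [ψ.tsupport_eq]
        intro h
        exact hy (Metric.closedBall_subset_ball (by simp [ψ, hr]) h)
      filter_upwards [notMem_tsupport_iff_eventuallyEq.1 this] with w hw
      simp [hw]
  · filter_upwards [ψ.eventuallyEq_one] with y hy
    simp [hy]

end Hadamard

/-! ### The bracket at a point depends only on differentials -/

section Poisson

variable {E : Type*} [NormedAddCommGroup E] [NormedSpace ℝ E]
  {P : Type*} [TopologicalSpace P] [ChartedSpace E P]

theorem mdifferentiableAt_smooth (F : Smooth E P) (z : P) :
    MDifferentiableAt 𝓘(ℝ, E) 𝓘(ℝ, ℝ) F z :=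
  F.contMDiff.mdifferentiableAt (by simp)

theorem differential_congr {f f' : P → ℝ} {z : P} (h : f =ᶠ[nhds z] f') :
    differential E f z = differential E f' z := by
  simp only [differential, mvfderiv, h.mfderiv_eq]
  rfl

theorem differential_add (F G : Smooth E P) (z : P) :
    differential E (F + G : Smooth E P) z = differential E F z + differential E G z :=
  mvfderiv_add (mdifferentiableAt_smooth F z) (mdifferentiableAt_smooth G z)

theorem differential_smul (c : ℝ) (F : Smooth E P) (z : P) :
    differential E (c • F : Smooth E P) z = c • differential E F z := by
  have := mvfderiv_smul (I := 𝓘(ℝ, E)) (x := z) (a := fun _ => c) mdifferentiableAt_const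
    (mdifferentiableAt_smooth F z)
  rw [mvfderiv_const] at this
  ext v
  simpa using! congr($this v)

theorem PoissonBracket.bracket_swap (π : PoissonBracket E P) (F G : Smooth E P) :
    π.bracket F G = -π.bracket G F := by
  have h := π.self_bracket (F + G)
  simp only [map_add, LinearMap.add_apply, π.self_bracket, zero_add, add_zero] at h
  exact eq_neg_of_add_eq_zero_left (by rw [← h, add_comm])

theorem PoissonBracket.bracket_mul_apply (π : PoissonBracket E P) (F G H : Smooth E P) (z : P) :
    π.bracket (F * G) H z = π.bracket F H z * G z + F z * π.bracket G H z := by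
  rw [π.leibniz]
  rfl

/-- Leibniz on 1 · 1 gives {1, G} = 2 {1, G}. -/
theorem PoissonBracket.bracket_const_apply (π : PoissonBracket E P) (c : ℝ) (G : Smooth E P)
    (z : P) : π.bracket (c • 1) G z = 0 := by
  have h := π.bracket_mul_apply 1 1 G z
  simp only [mul_one, ContMDiffMap.coe_one, Pi.one_apply, one_mul, left_eq_add] at h
  simp [h]

theorem differential_comp_extChartAt [IsManifold 𝓘(ℝ, E) 1 P] (z : P) {f : E → ℝ}
    (hf : DifferentiableAt ℝ f (extChartAt 𝓘(ℝ, E) z z)) :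
    differential E (fun p => f (extChartAt 𝓘(ℝ, E) z p)) z =
      (fderiv ℝ f (extChartAt 𝓘(ℝ, E) z z) : E →L[ℝ] ℝ) := by
  have hd : MDifferentiableAt 𝓘(ℝ, E) 𝓘(ℝ, ℝ) (fun p => f (extChartAt 𝓘(ℝ, E) z p)) z :=
    hf.mdifferentiableAt.comp z
      ((contMDiffAt_extChartAt (n := 1)).mdifferentiableAt one_ne_zero)
  refine hd.mvfderiv.trans ?_
  rw [modelWithCornersSelf_coe, range_id, fderivWithin_univ]
  refine Filter.EventuallyEq.fderiv_eq ?_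
  filter_upwards [extChartAt_target_mem_nhds (I := 𝓘(ℝ, E)) z] with y hy
  simp only [writtenInExtChartAt, extChartAt_model_space_eq_id, Function.comp,
    PartialEquiv.refl_coe, id]
  rw [(extChartAt 𝓘(ℝ, E) z).right_inv hy]

variable [FiniteDimensional ℝ E] [IsManifold 𝓘(ℝ, E) ∞ P] [T2Space P]

/-- A function smooth in the chart at `z` agrees near `z` with a globally smooth function. -/
theorem exists_smooth_eventuallyEq_comp_extChartAt (z : P) {f : E → ℝ} (hf : ContDiff ℝ ∞ f) :
    ∃ F : Smooth E P, F =ᶠ[nhds z] fun p => f (extChartAt 𝓘(ℝ, E) z p) := by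
  obtain ⟨χ⟩ : Nonempty (SmoothBumpFunction 𝓘(ℝ, E) z) := inferInstance
  refine ⟨⟨fun p => χ p • f (extChartAt 𝓘(ℝ, E) z p),
    χ.contMDiff_smul (hf.contMDiff.comp_contMDiffOn contMDiffOn_extChartAt)⟩, ?_⟩
  filter_upwards [χ.eventuallyEq_one] with p hp
  simp [hp]

/-- Every covector is the differential of a smooth function. -/
theorem exists_differential_eq (z : P) (α : Cotangent E z) :
    ∃ F : Smooth E P, differential E F z = α := by
  let α' : E →L[ℝ] ℝ := α
  obtain ⟨F, hF⟩ := exists_smooth_eventuallyEq_comp_extChartAt z α'.contDiff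
  refine ⟨F, ?_⟩
  rw [differential_congr hF, differential_comp_extChartAt z α'.differentiableAt, α'.fderiv]

/-- Locality: for a bump χ supported where F vanishes, χF = 0. Since F(z) = 0 and χ(z) = 1, Leibniz
for χF at z leaves only {F, G}(z). -/
theorem PoissonBracket.bracket_apply_eq_zero_of_eventuallyEq_zero (π : PoissonBracket E P)
    {F : Smooth E P} {z : P} (hF : F =ᶠ[nhds z] 0) (G : Smooth E P) : π.bracket F G z = 0 := by
  obtain ⟨χ, hχ, -⟩ := (SmoothBumpFunction.nhds_basis_support (I := 𝓘(ℝ, E)) hF).mem_iff.1 hF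
  let χ' : Smooth E P := ⟨χ, χ.contMDiff⟩
  have h0 : χ' * F = 0 := by
    ext p
    by_cases hp : p ∈ tsupport χ
    · have : F p = 0 := hχ hp
      simp [this]
    · have : χ' p = 0 := image_eq_zero_of_notMem_tsupport hp
      simp [this]
  have h1 := π.bracket_mul_apply χ' F G z
  have hz : F z = 0 := hF.self_of_nhds
  have hz' : χ' z = 1 := χ.eq_one
  rw [h0, hz, hz'] at h1
  simpa using h1.symm

/-- Smooth functions near `z`: if `dF(z) = 0` then `F` is near `z` a constant plus a sum of products
of functions vanishing at `z`. -/
theorem exists_eventuallyEq_sum_mul {F : Smooth E P} {z : P} (hF : differential E F z = 0) :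
    ∃ (n : ℕ) (A B : Fin n → Smooth E P), (∀ i, A i z = 0) ∧ (∀ i, B i z = 0) ∧
      F =ᶠ[nhds z] (F z • 1 + ∑ i, A i * B i : Smooth E P) := by
  let φ := extChartAt 𝓘(ℝ, E) z
  have hFφ : ContDiffOn ℝ ∞ (F ∘ φ.symm) φ.target :=
    (F.contMDiff.comp_contMDiffOn (contMDiffOn_extChartAt_symm z)).contDiffOn
  obtain ⟨f, hf, hfF⟩ := exists_contDiff_eventuallyEq (extChartAt_target_mem_nhds (I := 𝓘(ℝ, E)) z) hFφ
  have hfφ : F =ᶠ[nhds z] fun p => f (φ p) := by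
    filter_upwards [(continuousAt_extChartAt z).eventually hfF, 
      extChartAt_source_mem_nhds (I := 𝓘(ℝ, E)) z]
      with p hp hps
    rw [hp, Function.comp, φ.left_inv hps]
  have hdf : fderiv ℝ f (φ z) = 0 := by
    rw [differential_congr hfφ,
      differential_comp_extChartAt z (hf.differentiable (by simp) _)] at hF
    exact hF
  -- In a basis b, L(y)(y - φ z) is the sum of L(y)(b i) times the i-th coordinate of y - φ z. The
  -- first factors vanish at φ z because L(φ z) is the derivative there, which is zero.
  obtain ⟨L, hL, hL0, hLf⟩ := exists_contDiff_sub_eq_apply hf (φ z)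
  let b := Module.finBasis ℝ E
  choose A hA using fun i => exists_smooth_eventuallyEq_comp_extChartAt z
    (hL.clm_apply contDiff_const : ContDiff ℝ ∞ fun y => L y (b i))
  choose B hB using fun i => exists_smooth_eventuallyEq_comp_extChartAt z
    ((b.coord i).toContinuousLinearMap.contDiff.comp (contDiff_id.sub contDiff_const) :
      ContDiff ℝ ∞ fun y => (b.coord i).toContinuousLinearMap (y - φ z))
  refine ⟨_, A, B, fun i => ?_, fun i => ?_, ?_⟩
  · rw [(hA i).self_of_nhds]
    change L (φ z) (b i) = 0
    simp [hL0, hdf]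
  · rw [(hB i).self_of_nhds]
    simp [φ]
  · filter_upwards [hfφ, Filter.eventually_all.2 hA, Filter.eventually_all.2 hB] with p hp hAp hBp
    have hsum : (F z • 1 + ∑ i, A i * B i : Smooth E P) p = F z + ∑ i, A i p * B i p := by
      have : (∑ i, A i * B i : Smooth E P) p = ∑ i, A i p * B i p := by
        rw [← ContMDiffMap.coeFnRingHom_apply, map_sum, Finset.sum_apply]
        rfl
      rw [← this]
      simp
    rw [hsum, hp, hfφ.self_of_nhds, ← sub_eq_iff_eq_add', hLf]
    conv_lhs => rw [← b.sum_repr (φ p - φ z)]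
    simp only [map_sum, map_smul, smul_eq_mul, hAp, hBp]
    refine Finset.sum_congr rfl fun i _ => ?_
    rw [mul_comm]
    rfl

/-- The bracket at a point depends on a function only through its differential. -/
theorem PoissonBracket.bracket_apply_eq_zero_of_differential_eq_zero (π : PoissonBracket E P)
    {F : Smooth E P} {z : P} (hF : differential E F z = 0) (G : Smooth E P) :
    π.bracket F G z = 0 := by
  obtain ⟨n, A, B, hA, hB, h⟩ := exists_eventuallyEq_sum_mul hF
  let S : Smooth E P := F z • 1 + ∑ i, A i * B i
  have hS : π.bracket (F - S) G z = 0 :=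
    π.bracket_apply_eq_zero_of_eventuallyEq_zero (by
      filter_upwards [h] with p hp
      simp [S, hp]) G
  have hS' : π.bracket S G z = 0 := by
    have : ∀ i, π.bracket (A i * B i) G z = 0 := fun i => by
      rw [π.bracket_mul_apply, hA, hB]
      ring
    have hs : (∑ i, π.bracket (A i * B i) G : Smooth E P) z = 0 := by
      rw [← ContMDiffMap.coeFnRingHom_apply, map_sum, Finset.sum_apply]
      exact Finset.sum_eq_zero fun i _ => this i
    simp only [S, map_add, map_sum, LinearMap.add_apply, LinearMap.sum_apply]
    rw [ContMDiffMap.coe_add, Pi.add_apply, hs, π.bracket_const_apply, add_zero]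
  rw [map_sub, LinearMap.sub_apply, ContMDiffMap.coe_sub, Pi.sub_apply, hS', sub_zero] at hS
  exact hS

theorem PoissonBracket.bracket_apply_congr (π : PoissonBracket E P) {F F' G G' : Smooth E P}
    {z : P} (hF : differential E F z = differential E F' z)
    (hG : differential E G z = differential E G' z) :
    π.bracket F G z = π.bracket F' G' z := by
  have aux : ∀ {F F' : Smooth E P} (G : Smooth E P),
      differential E F z = differential E F' z → π.bracket F G z = π.bracket F' G z := by
    intro F F' G h
    have h0 : differential E (F + (-1 : ℝ) • F' : Smooth E P) z = 0 := by
      rw [differential_add, differential_smul, h]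
      ext v
      exact (congrArg _ (neg_one_mul _)).trans (add_neg_cancel _)
    have := π.bracket_apply_eq_zero_of_differential_eq_zero h0 G
    rw [map_add, map_smul] at this
    change π.bracket F G z + (-1) * π.bracket F' G z = 0 at this
    linarith
  rw [aux G hF, π.bracket_swap, π.bracket_swap F', ContMDiffMap.coe_neg, Pi.neg_apply, aux F' hG]
  rfl

/-- The choice in `tensor` is harmless: any two admissible pairs give the same bracket at z. -/
theorem PoissonBracket.tensor_differential (π : PoissonBracket E P) (z : P) (F G : Smooth E P) :
    π.tensor z (differential E F z) (differential E G z) = π.bracket F G z := by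
  obtain ⟨F', G', hF, hG, h⟩ := Classical.epsilon_spec
    (p := fun r : ℝ => ∃ F' G' : Smooth E P, differential E F' z = differential E F z ∧
      differential E G' z = differential E G z ∧ π.bracket F' G' z = r) ⟨_, F, G, rfl, rfl, rfl⟩
  rw [π.bracket_apply_congr hF hG] at h
  exact h.symm

theorem PoissonBracket.tensor_swap (π : PoissonBracket E P) (z : P) (α β : Cotangent E z) :
    π.tensor z α β = -π.tensor z β α := by
  obtain ⟨F, rfl⟩ := exists_differential_eq z α
  obtain ⟨G, rfl⟩ := exists_differential_eq z β
  rw [π.tensor_differential, π.tensor_differential, π.bracket_swap]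
  rfl

theorem PoissonBracket.tensor_add (π : PoissonBracket E P) (z : P) (α α' β : Cotangent E z) :
    π.tensor z (α + α') β = π.tensor z α β + π.tensor z α' β := by
  obtain ⟨F, rfl⟩ := exists_differential_eq z α
  obtain ⟨F', rfl⟩ := exists_differential_eq z α'
  obtain ⟨G, rfl⟩ := exists_differential_eq z β
  rw [← differential_add]
  simp only [π.tensor_differential, map_add]
  rfl

theorem PoissonBracket.tensor_smul (π : PoissonBracket E P) (z : P) (c : ℝ)
    (α β : Cotangent E z) : π.tensor z (c • α) β = c * π.tensor z α β := by
  obtain ⟨F, rfl⟩ := exists_differential_eq z α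
  obtain ⟨G, rfl⟩ := exists_differential_eq z β
  rw [← differential_smul]
  simp only [π.tensor_differential, map_smul]
  rfl

/-- The defining property of `B^♯`. -/
theorem PoissonBracket.apply_sharp (π : PoissonBracket E P) (z : P) (α β : Cotangent E z) :
    α (π.sharp z β) = π.tensor z α β := by
  have hex : ∃ v : TangentSpace 𝓘(ℝ, E) z, ∀ α : Cotangent E z, π.tensor z α β = α v := by
    -- Contraction with β is a linear form on covectors, hence evaluation at a vector, by
    -- reflexivity of the finite-dimensional E.
    let e : Module.Dual ℝ E ≃ₗ[ℝ] (E →L[ℝ] ℝ) := LinearMap.toContinuousLinearMap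
    let T : Module.Dual ℝ (Module.Dual ℝ E) :=
      { toFun := fun a => π.tensor z (e a) β
        map_add' := fun a a' => by
          rw [map_add]
          exact π.tensor_add z (e a) (e a') β
        map_smul' := fun c a => by
          rw [map_smul]
          exact π.tensor_smul z c (e a) β }
    refine ⟨(Module.evalEquiv ℝ E).symm T, fun α => ?_⟩
    have h := Module.apply_evalEquiv_symm_apply ℝ E (e.symm α) T
    exact (congrArg (fun a : E →L[ℝ] ℝ => π.tensor z a β) (e.apply_symm_apply α)).symm.trans
      h.symm
  exact (Classical.epsilon_spec hex α).symm

end Poisson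

/-! ### Regularity of feature maps -/

section FeatureMap

variable {E : Type*} [NormedAddCommGroup E] [NormedSpace ℝ E]
  {H : Type*} [NormedAddCommGroup H] [InnerProductSpace ℝ H]

/-- A feature map whose kernel is of class `C^2` is locally Lipschitz. -/
theorem exists_lipschitz_of_contDiffAt_inner {κ : E → H} {y₀ : E}
    (hκ : ContDiffAt ℝ 2 (fun q : E × E => inner ℝ (κ q.1) (κ q.2)) (y₀, y₀)) :
    ∃ C : ℝ, 0 ≤ C ∧ ∃ s ∈ nhds y₀, ∀ x ∈ s, ∀ y ∈ s, ‖κ x - κ y‖ ≤ C * ‖x - y‖ := by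
  let Φ : E × E → ℝ := fun q => inner ℝ (κ q.1) (κ q.2)
  have hd : ∀ᶠ q in nhds (y₀, y₀), DifferentiableAt ℝ Φ q := by
    filter_upwards [hκ.eventually (by simp)] with q hq
    exact hq.differentiableAt (by simp)
  obtain ⟨C, t, ht, hC⟩ := (hκ.fderiv_right (m := 1) (by norm_num)).exists_lipschitzOnWith
  obtain ⟨r, hr, hball⟩ := Metric.mem_nhds_iff.1 (Filter.inter_mem hd ht)
  have hmem : ∀ x ∈ Metric.ball y₀ r, ∀ y ∈ Metric.ball y₀ r,
      DifferentiableAt ℝ Φ (x, y) ∧ (x, y) ∈ t := fun x hx y hy =>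
    hball (by rw [← ball_prod_same]; exact ⟨hx, hy⟩)
  -- ‖κ x - κ y‖² is the increment from y to x of w ↦ Φ(x, w) - Φ(y, w). The derivative of this
  -- function is at most C‖x - y‖, as dΦ is C-Lipschitz, so the mean value inequality bounds the
  -- square by C‖x - y‖².
  refine ⟨√C, Real.sqrt_nonneg _, Metric.ball y₀ r, Metric.ball_mem_nhds _ hr,
    fun x hx y hy => ?_⟩
  have hg : ∀ w ∈ Metric.ball y₀ r, HasFDerivWithinAt (fun w => Φ (x, w) - Φ (y, w))
      ((fderiv ℝ Φ (x, w) - fderiv ℝ Φ (y, w)).comp (ContinuousLinearMap.inr ℝ E E))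
      (Metric.ball y₀ r) w := fun w hw => by
    have h1 := (hmem x hx w hw).1.hasFDerivAt.comp w (hasFDerivAt_prodMk_right x w)
    have h2 := (hmem y hy w hw).1.hasFDerivAt.comp w (hasFDerivAt_prodMk_right y w)
    rw [ContinuousLinearMap.sub_comp]
    exact (h1.sub h2).hasFDerivWithinAt
  have hb : ∀ w ∈ Metric.ball y₀ r,
      ‖(fderiv ℝ Φ (x, w) - fderiv ℝ Φ (y, w)).comp (ContinuousLinearMap.inr ℝ E E)‖ ≤
        C * ‖x - y‖ := fun w hw => by
    refine (ContinuousLinearMap.opNorm_comp_le _ _).trans ?_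
    have h1 := hC.norm_sub_le (hmem x hx w hw).2 (hmem y hy w hw).2
    have h2 : ‖((x, w) : E × E) - (y, w)‖ = ‖x - y‖ := by simp [Prod.norm_def]
    rw [h2] at h1
    exact (mul_le_of_le_one_right (norm_nonneg _) (ContinuousLinearMap.norm_inr_le_one ℝ E E)).trans
      h1
  have hmv := (convex_ball y₀ r).norm_image_sub_le_of_norm_hasFDerivWithin_le hg hb hy hx
  have hsq : ‖κ x - κ y‖ ^ 2 ≤ C * ‖x - y‖ ^ 2 := by
    rw [← real_inner_self_eq_norm_sq]
    refine le_trans (le_of_eq ?_) ((le_abs_self _).trans (hmv.trans (le_of_eq (by ring))))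
    simp only [Φ, inner_sub_left, inner_sub_right]
  calc ‖κ x - κ y‖ = √(‖κ x - κ y‖ ^ 2) := (Real.sqrt_sq (norm_nonneg _)).symm
    _ ≤ √(C * ‖x - y‖ ^ 2) := Real.sqrt_le_sqrt hsq
    _ = √C * ‖x - y‖ := by rw [Real.sqrt_mul' _ (sq_nonneg _), Real.sqrt_sq (norm_nonneg _)]

/-- For a feature map `κ` Lipschitz at `y₀`, the set of `f` such that `⟪f, κ ·⟫` is differentiable
at `y₀` is closed. -/
theorem isClosed_setOf_differentiableAt_inner {κ : E → H} {y₀ : E} {C : ℝ} (hC : 0 ≤ C)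
    (hκ : ∀ᶠ y in nhds y₀, ‖κ y - κ y₀‖ ≤ C * ‖y - y₀‖) :
    IsClosed {f : H | DifferentiableAt ℝ (fun y => inner ℝ f (κ y)) y₀} := by
  have hlip : ∀ f : H, ∀ᶠ y in nhds y₀,
      ‖inner ℝ f (κ y) - inner ℝ f (κ y₀)‖ ≤ (C * ‖f‖) * ‖y - y₀‖ := fun f => by
    filter_upwards [hκ] with y hy
    rw [← inner_sub_right]
    calc ‖inner ℝ f (κ y - κ y₀)‖ ≤ ‖f‖ * ‖κ y - κ y₀‖ := norm_inner_le_norm _ _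
      _ ≤ ‖f‖ * (C * ‖y - y₀‖) := by gcongr
      _ = _ := by ring
  refine isClosed_of_closure_subset fun f hf => ?_
  obtain ⟨u, hu, huf⟩ := mem_closure_iff_seq_limit.1 hf
  let D : ℕ → E →L[ℝ] ℝ := fun n => fderiv ℝ (fun y => inner ℝ (u n) (κ y)) y₀
  -- The Lipschitz bound on κ controls derivatives by norms in `H`, so convergence of `u` makes the
  -- derivatives Cauchy.
  have hD : ∀ m n, ‖D m - D n‖ ≤ C * ‖u m - u n‖ := fun m n => by
    have h := norm_fderiv_le_of_lip' ℝ (by positivity) (hlip (u m - u n))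
    simp only [inner_sub_left] at h
    rwa [fderiv_fun_sub (hu m) (hu n)] at h
  have hcau : CauchySeq D := by
    refine Metric.cauchySeq_iff.2 fun ε hε => ?_
    -- Dividing by C + 1 covers the case C = 0.
    obtain ⟨n₀, hn₀⟩ := Metric.cauchySeq_iff.1 huf.cauchySeq (ε / (C + 1)) (by positivity)
    refine ⟨n₀, fun m hm n hn => ?_⟩
    have h := hn₀ m hm n hn
    rw [dist_eq_norm, lt_div_iff₀ (by positivity)] at h
    rw [dist_eq_norm]
    nlinarith [hD m n, norm_nonneg (u m - u n)]
  obtain ⟨L, hL⟩ := cauchySeq_tendsto_of_complete hcau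
  refine HasFDerivAt.differentiableAt (f' := L) (.of_isLittleO (Asymptotics.isLittleO_iff.2
    fun c hc => ?_))
  obtain ⟨n, hn1, hn2⟩ : ∃ n, C * ‖f - u n‖ ≤ c / 3 ∧ ‖L - D n‖ ≤ c / 3 := by
    have h1 : Filter.Tendsto (fun n => C * ‖f - u n‖) Filter.atTop (nhds 0) := by
      simpa using ((tendsto_const_nhds (x := f)).sub huf).norm.const_mul C
    have h2 : Filter.Tendsto (fun n => ‖L - D n‖) Filter.atTop (nhds 0) := by
      simpa using ((tendsto_const_nhds (x := L)).sub hL).norm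
    exact ((h1.eventually_le_const (by positivity : (0 : ℝ) < c / 3)).and
      (h2.eventually_le_const (by positivity))).exists
  filter_upwards [hlip (f - u n), Asymptotics.isLittleO_iff.1 (hu n).hasFDerivAt.isLittleO
    (by positivity : (0 : ℝ) < c / 3)] with y hy1 hy2
  have hy3 : ‖(L - D n) (y - y₀)‖ ≤ c / 3 * ‖y - y₀‖ :=
    (ContinuousLinearMap.le_opNorm _ _).trans (by gcongr)
  have hy1' : ‖inner ℝ (f - u n) (κ y) - inner ℝ (f - u n) (κ y₀)‖ ≤ c / 3 * ‖y - y₀‖ :=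
    hy1.trans (by gcongr)
  have hsplit : inner ℝ f (κ y) - inner ℝ f (κ y₀) - L (y - y₀) =
      (inner ℝ (f - u n) (κ y) - inner ℝ (f - u n) (κ y₀)) +
      (inner ℝ (u n) (κ y) - inner ℝ (u n) (κ y₀) - D n (y - y₀)) - (L - D n) (y - y₀) := by
    simp only [inner_sub_left, sub_apply]
    ring
  rw [hsplit]
  refine (norm_sub_le _ _).trans ((add_le_add (norm_add_le _ _) le_rfl).trans ?_)
  linarith

end FeatureMap

/-! ### Invariance and differentiability in the reproducing kernel Hilbert space -/

section Kernel

variable {H : Type*} [NormedAddCommGroup H] [InnerProductSpace ℝ H]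

theorem IsRKHSOf.apply_eq_of_kernel_eq {X : Type*} [RKHS ℝ H X ℝ] {K : X → X → ℝ}
    (hH : IsRKHSOf H K) {x y : X} (h : ∀ w, K x w = K y w) (f : H) : f x = f y := by
  obtain ⟨k, hk, hfk⟩ := hH x
  obtain ⟨l, hl, hfl⟩ := hH y
  have : k = l := RKHS.ext fun w => by rw [hk, hl, h]
  rw [hfk, hfl, this]

theorem IsRKHSOf.isGInvariant {G X : Type*} [Monoid G] [MulAction G X] [RKHS ℝ H X ℝ]
    {K : X → X → ℝ} (hH : IsRKHSOf H K) (hK : IsArgumentwiseInvariant G K) (f : H) :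
    IsGInvariant G fun p => f p := fun a p =>
  hH.apply_eq_of_kernel_eq (fun w => by simpa using hK a 1 p w) f

variable {E : Type*} [NormedAddCommGroup E] [NormedSpace ℝ E]
  {P : Type*} [TopologicalSpace P] [ChartedSpace E P] [IsManifold 𝓘(ℝ, E) ∞ P]

/-- The functions in the reproducing kernel Hilbert space of a `C^2` kernel are differentiable. -/
theorem IsRKHSOf.mdifferentiableAt [CompleteSpace H] [RKHS ℝ H P ℝ] {K : P → P → ℝ}
    (hH : IsRKHSOf H K)
    (hK : ContMDiff (𝓘(ℝ, E).prod 𝓘(ℝ, E)) 𝓘(ℝ, ℝ) 2 fun p : P × P => K p.1 p.2)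
    (f : H) (z : P) : MDifferentiableAt 𝓘(ℝ, E) 𝓘(ℝ, ℝ) (fun p => f p) z := by
  choose k hk hfk using hH
  let φ := extChartAt 𝓘(ℝ, E) z
  have hφ : ContMDiffAt 𝓘(ℝ, E) 𝓘(ℝ, E) 2 φ.symm (φ z) :=
    (contMDiffOn_extChartAt_symm z).contMDiffAt (extChartAt_target_mem_nhds z)
  have hΦ : ContDiffAt ℝ 2 (fun q : E × E => inner ℝ (k (φ.symm q.1)) (k (φ.symm q.2)))
      (φ z, φ z) := by
    simp only [← hfk, hk]
    rw [← contMDiffAt_iff_contDiffAt]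
    have h1 : ContMDiffAt 𝓘(ℝ, E × E) 𝓘(ℝ, E) 2 (fun q : E × E => φ.symm q.1) (φ z, φ z) :=
      hφ.comp (φ z, φ z) contDiff_fst.contDiffAt.contMDiffAt
    have h2 : ContMDiffAt 𝓘(ℝ, E × E) 𝓘(ℝ, E) 2 (fun q : E × E => φ.symm q.2) (φ z, φ z) :=
      hφ.comp (φ z, φ z) contDiff_snd.contDiffAt.contMDiffAt
    exact hK.contMDiffAt.comp (φ z, φ z) (h1.prodMk h2)
  obtain ⟨C, hC, s, hs, hlip⟩ := exists_lipschitz_of_contDiffAt_inner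
    (κ := fun y => k (φ.symm y)) hΦ
  have hclosed := isClosed_setOf_differentiableAt_inner hC (κ := fun y => k (φ.symm y))
    (y₀ := φ z) (Filter.mem_of_superset hs fun y hy => hlip y hy _ (mem_of_mem_nhds hs))
  let S : Submodule ℝ H :=
    { carrier := {f | DifferentiableAt ℝ (fun y => inner ℝ f (k (φ.symm y))) (φ z)}
      zero_mem' := by simp
      add_mem' := fun {f f'} hf hf' => by
        simp only [mem_ofPred_eq, inner_add_left]
        exact hf.add hf'
      smul_mem' := fun c f hf => by
        simp only [mem_ofPred_eq, inner_smul_left]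
        exact hf.const_mul _ }
  have hkS : ∀ x, k x ∈ S := fun x => by
    change DifferentiableAt ℝ (fun y => inner ℝ (k x) (k (φ.symm y))) (φ z)
    simp only [← hfk, hk]
    have h : ContMDiffAt 𝓘(ℝ, E) 𝓘(ℝ, ℝ) 2 (fun y => K x (φ.symm y)) (φ z) :=
      hK.contMDiffAt.comp (φ z) (contMDiffAt_const.prodMk hφ)
    exact (contMDiffAt_iff_contDiffAt.1 h).differentiableAt (by simp)
  -- A vector orthogonal to S is orthogonal to every section `k x`, so it vanishes at every x by the
  -- reproducing property. Thus S is dense, and it is closed.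
  have hS : S = ⊤ := by
    rw [← IsClosed.submodule_topologicalClosure_eq (s := S) hclosed,
      Submodule.topologicalClosure_eq_top_iff, Submodule.eq_bot_iff]
    intro f hf
    refine RKHS.ext fun x => ?_
    rw [hfk, real_inner_comm, (Submodule.mem_orthogonal S f).1 hf _ (hkS x)]
    simp
  have hf : DifferentiableAt ℝ (fun y => f (φ.symm y)) (φ z) := by
    have : f ∈ S := hS ▸ Submodule.mem_top
    simp only [hfk]
    exact this
  refine (hf.mdifferentiableAt.comp z
    ((contMDiffAt_extChartAt (n := 1)).mdifferentiableAt one_ne_zero)).congr_of_eventuallyEq ?_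
  filter_upwards [extChartAt_source_mem_nhds (I := 𝓘(ℝ, E)) z] with p hp
  simp only [Function.comp, φ, (extChartAt 𝓘(ℝ, E) z).left_inv hp]

end Kernel

/-! ### Conservation of the momentum map -/

section Noether

variable {E : Type*} [NormedAddCommGroup E] [NormedSpace ℝ E]
  {P : Type*} [TopologicalSpace P] [ChartedSpace E P]

/-- A differentiable function annihilated by a vector field is constant along its flow. -/
theorem FlowsTo.apply_eq {X : ∀ z : P, TangentSpace 𝓘(ℝ, E) z} {t : ℝ} {p q : P}
    (h : FlowsTo X t p q) {f : P → ℝ} (hf : ∀ z, MDifferentiableAt 𝓘(ℝ, E) 𝓘(ℝ, ℝ) f z)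
    (hX : ∀ z, differential E f z (X z) = 0) : f q = f p := by
  obtain ⟨γ, a, b, h0, ht, hγ, rfl, rfl⟩ := h
  have hd : ∀ s ∈ Ioo a b, HasDerivAt (fun s => f (γ s)) 0 s := fun s hs => by
    have h1 := (hγ s hs).hasMFDerivAt (isOpen_Ioo.mem_nhds hs)
    let v : E := X (γ s)
    let D : E →L[ℝ] ℝ := differential E f (γ s)
    have h2 : HasFDerivAt (fun s => f (γ s)) (D.comp ((1 : ℝ →L[ℝ] ℝ).smulRight v)) s :=
      ((hf (γ s)).hasMFDerivAt.comp s h1).hasFDerivAt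
    have hv : D v = 0 := hX (γ s)
    simpa [hv] using h2.hasDerivAt
  exact isOpen_Ioo.is_const_of_deriv_eq_zero isPreconnected_Ioo
    (fun s hs => (hd s hs).differentiableAt.differentiableWithinAt)
    (fun s hs => (hd s hs).deriv) ht h0

/-- An invariant differentiable function is annihilated by the infinitesimal generators. -/
theorem differential_infGenerator_eq_zero
    {EG : Type*} [NormedAddCommGroup EG] [NormedSpace ℝ EG]
    {G : Type*} [TopologicalSpace G] [ChartedSpace EG G] [Group G] [MulAction G P]
    [ContMDiffSMul 𝓘(ℝ, EG) 𝓘(ℝ, E) ∞ G P] {h : P → ℝ} (hinv : IsGInvariant G h) {p : P}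
    (hd : MDifferentiableAt 𝓘(ℝ, E) 𝓘(ℝ, ℝ) h p) (ξ : GroupLieAlgebra 𝓘(ℝ, EG) G) :
    differential E h p (infGenerator ξ p) = 0 := by
  have horb : MDifferentiableAt 𝓘(ℝ, EG) 𝓘(ℝ, E) (fun a : G => a • p) 1 := by
    have h := (contMDiff_smul (I := 𝓘(ℝ, EG)) (I' := 𝓘(ℝ, E)) (n := ∞) (G := G) (M := P)).comp
      (contMDiff_id.prodMk (contMDiff_const (c := p)))
    exact h.mdifferentiableAt (by simp)
  have hcomp := mvfderiv_comp_apply_of_eq (1 : G) hd horb (one_smul G p) ξ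
  have hconst : h ∘ (fun a : G => a • p) = fun _ => h p := funext fun a => hinv a p
  rw [hconst, mvfderiv_const] at hcomp
  exact hcomp.symm

variable [FiniteDimensional ℝ E] [IsManifold 𝓘(ℝ, E) ∞ P] [T2Space P]

/-- This exchanges conservation of f along X_h for invariance of h along X_f. -/
theorem PoissonBracket.differential_hamVF_swap (π : PoissonBracket E P) (f h : P → ℝ) (z : P) :
    differential E f z (π.hamVF h z) = -differential E h z (π.hamVF f z) := by
  rw [hamVF, hamVF, π.apply_sharp, π.apply_sharp, π.tensor_swap]

/-- Noether's theorem: a momentum map is conserved by the flow of the Hamiltonian vector field of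
an invariant differentiable function. -/
theorem IsMomentumMap.conserved
    {EG : Type*} [NormedAddCommGroup EG] [NormedSpace ℝ EG]
    {G : Type*} [TopologicalSpace G] [ChartedSpace EG G] [Group G] [MulAction G P]
    [ContMDiffSMul 𝓘(ℝ, EG) 𝓘(ℝ, E) ∞ G P] {π : PoissonBracket E P}
    {J : P → Module.Dual ℝ (GroupLieAlgebra 𝓘(ℝ, EG) G)} (hJ : IsMomentumMap π J)
    {h : P → ℝ} (hinv : IsGInvariant G h)
    (hd : ∀ z, MDifferentiableAt 𝓘(ℝ, E) 𝓘(ℝ, ℝ) h z) {t : ℝ} {p q : P}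
    (hpq : FlowsTo (π.hamVF h) t p q) : J q = J p := by
  ext ξ
  obtain ⟨hsmooth, hgen⟩ := hJ ξ
  refine hpq.apply_eq (f := fun p => J p ξ) (fun z => hsmooth.mdifferentiableAt (by simp))
    fun z => ?_
  rw [π.differential_hamVF_swap, ← hgen z, differential_infGenerator_eq_zero hinv (hd z) ξ,
    neg_zero]

end Noether

end PoissonLearning

theorem mainTheorem10
    {E : Type*} [NormedAddCommGroup E] [NormedSpace ℝ E] [FiniteDimensional ℝ E]
    {P : Type*} [TopologicalSpace P] [ChartedSpace E P] [IsManifold 𝓘(ℝ, E) ∞ P]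
    [T2Space P] [SecondCountableTopology P]
    {EG : Type*} [NormedAddCommGroup EG] [NormedSpace ℝ EG] [FiniteDimensional ℝ EG]
    {G : Type*} [TopologicalSpace G] [ChartedSpace EG G] [Group G] [LieGroup 𝓘(ℝ, EG) ∞ G]
    [MulAction G P] [ContMDiffSMul 𝓘(ℝ, EG) 𝓘(ℝ, E) ∞ G P]
    (π : PoissonBracket E P) (g : RiemannianMetricOn E P)
    (hG : IsCanonicalAction G π)
    (K : P → P → ℝ) (hK : IsMercerKernel K)
    (hK3 : ContMDiff (𝓘(ℝ, E).prod 𝓘(ℝ, E)) 𝓘(ℝ, ℝ) 3 (fun p : P × P => K p.1 p.2))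
    (hinv : IsArgumentwiseInvariant G K)
    {H : Type*} [NormedAddCommGroup H] [InnerProductSpace ℝ H] [CompleteSpace H]
    [RKHS ℝ H P ℝ] (hH : IsRKHSOf H K)
    {N : ℕ} (hN : 0 < N) (z : Fin N → P) (x : ∀ n, TangentSpace 𝓘(ℝ, E) (z n))
    {lam : ℝ} (hlam : 0 < lam)
    (hhat : H) (hhat_est : IsKernelEstimator π g z x lam hhat) :
    IsGInvariant G (fun p => hhat p) ∧
      ∀ J : P → Module.Dual ℝ (GroupLieAlgebra 𝓘(ℝ, EG) G), IsMomentumMap π J →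
        ∀ (t : ℝ) (p q : P), FlowsTo (π.hamVF (fun p' => hhat p')) t p q → J q = J p := by
  refine ⟨hH.isGInvariant hinv hhat, fun J hJ t p q hpq => ?_⟩
  exact hJ.conserved (hH.isGInvariant hinv hhat)
    (hH.mdifferentiableAt (hK3.of_le (by norm_num)) hhat) hpq
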